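/- There is a universal constant $C>0$ such that the following holds for all integers $m,n\ge 0$ and $k\ge 2$. Let $A=(a_j)_{j=1}^n\in\mathbb{R}^{m\times n}$ be a real matrix with columns $a_1,\dots,a_n$, and let $F\in\mathbb{R}^{m\times m}$ be a matrix of rank $m$ such that $a_j\in E=F B_2^m=\{Fy : y\in\mathbb{R}^m,\ \|y\|_2\le 1\}$ for every $j\in\{1,\dots,n\}$. Then for any vectors $v_1,\dots,v_k\in\mathbb{R}^m$ there exists $x\in\{-1,1\}^n$ such that $$|\langle Ax,v_i\rangle|\le C\sqrt{(v_i^{T}FF^{T}v_i)\,\log k}\qquad\text{for all } i\in\{1,\dots,k\}.$$ -/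

import Mathlib

open scoped Matrix

/-- The closed Euclidean unit ball of `ℝ^m`, as a set of coordinate vectors. The norm used is the
`ℓ₂` norm of `EuclideanSpace ℝ (Fin m)` (not the sup norm of `Fin m → ℝ`). -/
def unitBall2 (m : ℕ) : Set (Fin m → ℝ) :=
  {y | ‖(WithLp.toLp 2 y : EuclideanSpace ℝ (Fin m))‖ ≤ 1}

/-- The symmetric ellipsoid `F B_2^m`, the image of the Euclidean unit ball under `F`. -/
def ellipsoidOf {m : ℕ} (F : Matrix (Fin m) (Fin m) ℝ) : Set (Fin m → ℝ) :=
  (fun y => F *ᵥ y) '' unitBall2 m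

/-! Writing `a_j = F w_j` with `‖w_j‖ ≤ 1` turns `⟨Ax, v_i⟩` into `⟨∑ x_j w_j, Fᵀ v_i⟩`, so it
suffices to balance vectors of norm at most one against `k` test vectors. This is done by a
derandomized Gram–Schmidt walk. From `x = 0`, with a pivot `p` among the unfrozen coordinates, `x`
moves so that `∑ x_j w_j` changes along the component of `w_p` orthogonal to the other free vectors,
until a coordinate reaches `±1` and is frozen.

The potential sums, over the test vectors `θ`, the product of `exp ⟨∑ x_j w_j, θ⟩`, of `exp ‖Pθ‖²`
with `P` the projection onto the free span, and of `dampedMgf`, which accounts for the sign still to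
be given to the pivot. Along the walk direction it is affine (`exists_affine_direction`), so one
orientation does not increase it. Freezing the pivot (`freePotential_le_pivotPotential`), freezing
another coordinate (`pivotPotential_mono`) and choosing a new pivot
(`pivotPotential_le_freePotential`) do not increase it either. Hence the final signs satisfy `∑ exp
⟨∑ y_j w_j, θ_i⟩ ≤ ∑ exp ‖θ_i‖²`; taking `θ` to be `±` the test vectors rescaled to length `√(log
k)` gives the bound. -/

/-! ### Scalar estimates for the sign moment generating function -/

/-- The moment generating function at `s` of the centred `±1` variable with bias `x`. -/
noncomputable def signMgf (x s : ℝ) : ℝ :=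
  Real.exp (-(x * s)) * (Real.cosh s + x * Real.sinh s)

theorem signMgf_neg (x s : ℝ) : signMgf x (-s) = signMgf (-x) s := by
  simp [signMgf]

theorem signMgf_zero (x : ℝ) : signMgf x 0 = 1 := by
  simp [signMgf]

theorem signMgf_of_abs_eq_one {x : ℝ} (hx : |x| = 1) (s : ℝ) : signMgf x s = 1 := by
  rcases (abs_eq zero_le_one).1 hx with rfl | rfl
  · rw [signMgf, one_mul, one_mul, Real.cosh_add_sinh, ← Real.exp_add]; simp
  · rw [signMgf, neg_one_mul, neg_one_mul, neg_neg, ← sub_eq_add_neg, Real.cosh_sub_sinh,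
      ← Real.exp_add]
    simp

theorem hasDerivAt_signMgf (x s : ℝ) :
    HasDerivAt (signMgf x) (Real.exp (-(x * s)) * ((1 - x ^ 2) * Real.sinh s)) s := by
  have h1 : HasDerivAt (fun s : ℝ => Real.exp (-(x * s))) (Real.exp (-(x * s)) * (-(x * 1))) s :=
    ((hasDerivAt_id s).const_mul x).neg.exp
  have h2 : HasDerivAt (fun s : ℝ => Real.cosh s + x * Real.sinh s)
      (Real.sinh s + x * Real.cosh s) s :=
    (Real.hasDerivAt_cosh s).add ((Real.hasDerivAt_sinh s).const_mul x)
  exact (h1.mul h2).congr_deriv (by ring)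

theorem sinh_le_mul_cosh {s : ℝ} (hs : 0 ≤ s) : Real.sinh s ≤ s * Real.cosh s := by
  have hd : ∀ y : ℝ, HasDerivAt (fun s : ℝ => s * Real.cosh s - Real.sinh s)
      (y * Real.sinh y) y := fun y =>
    (((hasDerivAt_id y).mul (Real.hasDerivAt_cosh y)).sub (Real.hasDerivAt_sinh y)).congr_deriv
      (by simp)
  have hm : MonotoneOn (fun s : ℝ => s * Real.cosh s - Real.sinh s) (Set.Ici 0) := by
    refine monotoneOn_of_hasDerivWithinAt_nonneg (convex_Ici 0)
      (fun y _ => (hd y).continuousAt.continuousWithinAt)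
      (fun y _ => (hd y).hasDerivWithinAt) (fun y hy => ?_)
    rw [interior_Ici] at hy
    exact mul_nonneg (le_of_lt hy) (Real.sinh_nonneg_iff.2 (le_of_lt hy))
  have := hm (Set.self_mem_Ici) hs hs
  simp at this
  linarith

theorem signMgf_monotoneOn {x : ℝ} (hx : |x| ≤ 1) : MonotoneOn (signMgf x) (Set.Ici 0) := by
  refine monotoneOn_of_hasDerivWithinAt_nonneg (convex_Ici 0)
    (fun y _ => (hasDerivAt_signMgf x y).continuousAt.continuousWithinAt)
    (fun y _ => (hasDerivAt_signMgf x y).hasDerivWithinAt) (fun y hy => ?_)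
  rw [interior_Ici] at hy
  have h2 : 0 ≤ Real.sinh y := Real.sinh_nonneg_iff.2 (le_of_lt hy)
  have h3 : 0 ≤ 1 - x ^ 2 := by rw [sub_nonneg, ← sq_abs]; exact pow_le_one₀ (abs_nonneg x) hx
  positivity

/-- The function `signMgf x s`, damped by the Gaussian factor `exp (-s ^ 2)`. -/
noncomputable def dampedMgf (x s : ℝ) : ℝ := signMgf x s * Real.exp (-s ^ 2)

theorem dampedMgf_neg (x s : ℝ) : dampedMgf x (-s) = dampedMgf (-x) s := by
  simp [dampedMgf, signMgf_neg]

theorem dampedMgf_antitoneOn {x : ℝ} (hx : |x| ≤ 1) : AntitoneOn (dampedMgf x) (Set.Ici 0) := by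
  have hd : ∀ y : ℝ, HasDerivAt (dampedMgf x)
      (Real.exp (-(x * y)) * Real.exp (-y ^ 2) *
        ((1 - x ^ 2) * Real.sinh y - 2 * y * (Real.cosh y + x * Real.sinh y))) y := by
    intro y
    have h1 : HasDerivAt (fun s : ℝ => Real.exp (-s ^ 2))
        (Real.exp (-y ^ 2) * (-(2 * y))) y :=
      ((hasDerivAt_pow 2 y).neg.exp).congr_deriv (by simp)
    exact ((hasDerivAt_signMgf x y).mul h1).congr_deriv (by rw [signMgf]; ring)
  refine antitoneOn_of_hasDerivWithinAt_nonpos (convex_Ici 0)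
    (fun y _ => (hd y).continuousAt.continuousWithinAt)
    (fun y _ => (hd y).hasDerivWithinAt) (fun y hy => ?_)
  rw [interior_Ici] at hy
  have hy : 0 < y := hy
  obtain ⟨hx1, hx2⟩ := abs_le.1 hx
  have h1 : 0 ≤ Real.sinh y := Real.sinh_nonneg_iff.2 hy.le
  have h2 := sinh_le_mul_cosh hy.le
  have h3 : Real.sinh y ≤ Real.cosh y := (Real.sinh_lt_cosh y).le
  refine mul_nonpos_of_nonneg_of_nonpos (by positivity) ?_
  rcases le_total 0 x with h0 | h0
  · have h4 : 0 ≤ y * (x * Real.sinh y) := by positivity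
    have h5 : 0 ≤ x ^ 2 * Real.sinh y := by positivity
    nlinarith [mul_pos hy (Real.cosh_pos y)]
  -- The sum `h4 + 2 * h5 + 2 * h6` is exactly the required inequality.
  · have h4 : 0 ≤ (1 + x) * (1 + x) * Real.sinh y := mul_nonneg (mul_self_nonneg _) h1
    have h5 : 0 ≤ (1 + x) * (y * Real.cosh y - Real.sinh y) :=
      mul_nonneg (by linarith) (by linarith)
    have h6 : 0 ≤ -x * (y * (Real.cosh y - Real.sinh y)) :=
      mul_nonneg (by linarith) (mul_nonneg hy.le (by linarith))
    nlinarith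

theorem one_le_signMgf {x : ℝ} (hx : |x| ≤ 1) (s : ℝ) : 1 ≤ signMgf x s := by
  have key : ∀ {x s : ℝ}, |x| ≤ 1 → 0 ≤ s → 1 ≤ signMgf x s := fun {x s} hx hs => by
    simpa [signMgf_zero] using signMgf_monotoneOn hx Set.self_mem_Ici hs hs
  rcases le_total 0 s with hs | hs
  · exact key hx hs
  · have := key (x := -x) (s := -s) (by rwa [abs_neg]) (by linarith)
    rwa [signMgf_neg, neg_neg] at this

theorem dampedMgf_le_one {x : ℝ} (hx : |x| ≤ 1) (s : ℝ) : dampedMgf x s ≤ 1 := by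
  have key : ∀ {x s : ℝ}, |x| ≤ 1 → 0 ≤ s → dampedMgf x s ≤ 1 := fun {x s} hx hs => by
    simpa [signMgf_zero, dampedMgf] using dampedMgf_antitoneOn hx Set.self_mem_Ici hs hs
  rcases le_total 0 s with hs | hs
  · exact key hx hs
  · have := key (x := -x) (s := -s) (by rwa [abs_neg]) (by linarith)
    rwa [dampedMgf_neg, neg_neg] at this

theorem dampedMgf_nonneg {x : ℝ} (hx : |x| ≤ 1) (s : ℝ) : 0 ≤ dampedMgf x s :=
  mul_nonneg (zero_le_one.trans (one_le_signMgf hx s)) (Real.exp_pos _).le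

theorem dampedMgf_add_le_of_mul_nonneg {x s t : ℝ} (hx : |x| ≤ 1) (h : 0 ≤ s * t) :
    dampedMgf x (s + t) ≤ dampedMgf x s := by
  have key : ∀ {x s t : ℝ}, |x| ≤ 1 → 0 ≤ s → 0 ≤ t → dampedMgf x (s + t) ≤ dampedMgf x s :=
    fun {x s t} hx hs ht =>
      dampedMgf_antitoneOn hx hs (add_nonneg hs ht) (le_add_of_nonneg_right ht)
  rcases mul_nonneg_iff.1 h with ⟨hs, ht⟩ | ⟨hs, ht⟩
  · exact key hx hs ht
  · have := key (x := -x) (s := -s) (t := -t) (by rwa [abs_neg]) (by linarith) (by linarith)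
    rwa [← neg_add, dampedMgf_neg, dampedMgf_neg, neg_neg] at this

/-- Moving `s` towards or past zero may increase `dampedMgf`; the factor `exp (-(4 * (s * t)))` is
chosen to match the projection loss in `neg_four_mul_le_starProjection_gap`. -/
theorem dampedMgf_add_le_of_mul_nonpos {x s t : ℝ} (hx : |x| ≤ 1) (h : s * t ≤ 0) :
    dampedMgf x (s + t) ≤ dampedMgf x s * Real.exp (-(4 * (s * t))) := by
  have key : ∀ {x s t : ℝ}, |x| ≤ 1 → 0 ≤ s → t ≤ 0 →
      dampedMgf x (s + t) ≤ dampedMgf x s * Real.exp (-(4 * (s * t))) := by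
    intro x s t hx hs ht
    have hst : 0 ≤ -(s * t) := by nlinarith
    rw [dampedMgf.eq_1 x s, mul_assoc, ← Real.exp_add]
    -- Before zero is crossed, `signMgf` decreases and the Gaussian exponents suffice; after
    -- crossing, the left side is at most 1 and `-s² - 4st ≥ 0` because `t ≤ -s`.
    rcases le_total 0 (s + t) with h0 | h0
    · refine mul_le_mul (signMgf_monotoneOn hx h0 hs (by linarith)) ?_ (Real.exp_pos _).le
        (zero_le_one.trans (one_le_signMgf hx s))
      rw [Real.exp_le_exp]
      nlinarith [sq_nonneg t]
    · refine (dampedMgf_le_one hx _).trans (one_le_mul_of_one_le_of_one_le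
        (one_le_signMgf hx s) (Real.one_le_exp ?_))
      nlinarith
  rcases mul_nonpos_iff.1 h with ⟨hs, ht⟩ | ⟨hs, ht⟩
  · exact key hx hs ht
  · have := key (x := -x) (s := -s) (t := -t) (by rwa [abs_neg]) (by linarith) (by linarith)
    rwa [← neg_add, dampedMgf_neg, dampedMgf_neg, neg_neg, neg_mul_neg] at this

/-! ### Loss of projection length when a subspace shrinks -/

section Projection

variable {E : Type*} [NormedAddCommGroup E] [InnerProductSpace ℝ E] [FiniteDimensional ℝ E]

theorem norm_sq_starProjection_sub {U V : Submodule ℝ E} (h : V ≤ U) (θ : E) :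
    ‖U.starProjection θ - V.starProjection θ‖ ^ 2 =
      ‖U.starProjection θ‖ ^ 2 - ‖V.starProjection θ‖ ^ 2 := by
  have h1 : inner ℝ (U.starProjection θ - V.starProjection θ) (V.starProjection θ) = 0 := by
    have hU := U.starProjection_inner_eq_zero θ _ (h (V.starProjection_apply_mem θ))
    have hV := V.starProjection_inner_eq_zero θ _ (V.starProjection_apply_mem θ)
    rw [inner_sub_left] at *
    linarith
  have h2 := norm_add_sq_real (U.starProjection θ - V.starProjection θ) (V.starProjection θ)
  rw [sub_add_cancel, h1] at h2
  linarith

theorem norm_sq_starProjection_mono {U V : Submodule ℝ E} (h : V ≤ U) (θ : E) :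
    ‖V.starProjection θ‖ ^ 2 ≤ ‖U.starProjection θ‖ ^ 2 := by
  have := norm_sq_starProjection_sub h θ
  nlinarith [sq_nonneg ‖U.starProjection θ - V.starProjection θ‖]

/-- On `z` the vector `θ` acts only through the difference of its two projections, so this is
Cauchy–Schwarz combined with Pythagoras. -/
theorem inner_sq_le_norm_sq_mul_starProjection_gap {U V : Submodule ℝ E} (h : V ≤ U) {z : E}
    (hzU : z ∈ U) (hzV : ∀ y ∈ V, inner ℝ z y = 0) (θ : E) :
    inner ℝ z θ ^ 2 ≤
      ‖z‖ ^ 2 * (‖U.starProjection θ‖ ^ 2 - ‖V.starProjection θ‖ ^ 2) := by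
  have h1 : inner ℝ z θ = inner ℝ z (U.starProjection θ - V.starProjection θ) := by
    have hU := U.starProjection_inner_eq_zero θ z hzU
    rw [inner_sub_right, hzV _ (V.starProjection_apply_mem θ), sub_zero]
    rw [inner_sub_left, real_inner_comm, real_inner_comm z] at hU
    linarith
  rw [← norm_sq_starProjection_sub h, h1, ← mul_pow, ← sq_abs]
  exact pow_le_pow_left₀ (abs_nonneg _) (abs_real_inner_le_norm _ _) 2

/-- Shrinking `U` to `V` while keeping the vector `w`: when the inner product of `θ` with the
component of `w` orthogonal to the subspace changes towards the opposite sign, the projection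
of `θ` onto the sum with the line of `w` shortens accordingly. -/
theorem neg_four_mul_le_starProjection_gap {U V : Submodule ℝ E} (h : V ≤ U) {w : E}
    (hw : ‖w‖ ≤ 1) (θ : E) {s t : ℝ} (hs : s = inner ℝ (w - U.starProjection w) θ)
    (ht : s + t = inner ℝ (w - V.starProjection w) θ) :
    -(4 * (s * t)) ≤ ‖(U ⊔ ℝ ∙ w).starProjection θ‖ ^ 2 -
      ‖(V ⊔ ℝ ∙ w).starProjection θ‖ ^ 2 := by
  have hle : V ⊔ ℝ ∙ w ≤ U ⊔ ℝ ∙ w := sup_le_sup_right h _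
  have hmono := norm_sq_starProjection_mono hle θ
  obtain ⟨r, hr⟩ : ∃ r, r = w - U.starProjection w := ⟨_, rfl⟩
  obtain ⟨d, hd⟩ : ∃ d, d = U.starProjection w - V.starProjection w := ⟨_, rfl⟩
  have hrd : w - V.starProjection w = r + d := by rw [hr, hd]; abel
  have hwV : w = (r + d) + V.starProjection w := by rw [← hrd]; abel
  have hdU : d ∈ U := hd ▸ U.sub_mem (U.starProjection_apply_mem w)
    (h (V.starProjection_apply_mem w))
  have hrU : ∀ y ∈ U, inner ℝ r y = 0 := fun y hy => hr ▸ U.starProjection_inner_eq_zero w y hy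
  have hrdV : ∀ y ∈ V, inner ℝ (r + d) y = 0 := fun y hy =>
    hrd ▸ V.starProjection_inner_eq_zero w y hy
  have hdV : ∀ y ∈ V, inner ℝ d y = 0 := fun y hy => by
    have := hrdV y hy
    rwa [inner_add_left, hrU y (h hy), zero_add] at this
  have hrd0 : inner ℝ r d = 0 := hrU d hdU
  have hdr0 : inner ℝ d r = 0 := by rw [real_inner_comm, hrd0]
  rw [← hr] at hs
  have ht' : t = inner ℝ d θ := by
    rw [hrd, inner_add_left] at ht
    linarith
  have hnorm : ‖r‖ ^ 2 + ‖d‖ ^ 2 ≤ 1 := by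
    have e1 := norm_add_sq_real (r + d) (V.starProjection w)
    rw [← hwV, hrdV _ (V.starProjection_apply_mem w)] at e1
    have e2 := norm_add_sq_real r d
    rw [hrd0] at e2
    nlinarith [norm_nonneg w, sq_nonneg ‖V.starProjection w‖]
  -- In the plane of the orthogonal vectors `r` and `d`, this `z` is the direction orthogonal to `r
  -- + d`, hence to `V ⊔ ℝ ∙ w`: it is what is lost when `U` shrinks to `V`. The constant 4 comes
  -- from `(as - bt)² ≥ -4abst` with `a = ‖d‖²`, `b = ‖r‖²`.
  have hz := inner_sq_le_norm_sq_mul_starProjection_gap hle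
    (z := ‖d‖ ^ 2 • r - ‖r‖ ^ 2 • d)
    (by
      refine Submodule.sub_mem _ (Submodule.smul_mem _ _ ?_) (Submodule.smul_mem _ _ ?_)
      · rw [hr]
        exact Submodule.sub_mem _
          (Submodule.mem_sup_right (Submodule.mem_span_singleton_self w))
          (Submodule.mem_sup_left (U.starProjection_apply_mem w))
      · exact Submodule.mem_sup_left hdU)
    (by
      intro y hy
      obtain ⟨v, hv, c, hc, rfl⟩ := Submodule.mem_sup.1 hy
      obtain ⟨a, rfl⟩ := Submodule.mem_span_singleton.1 hc
      have hVw := V.starProjection_apply_mem w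
      have e1 : inner ℝ r w = ‖r‖ ^ 2 := by
        rw [hwV, inner_add_right, inner_add_right, hrU _ (h hVw), hrd0,
          real_inner_self_eq_norm_sq]
        ring
      have e2 : inner ℝ d w = ‖d‖ ^ 2 := by
        rw [hwV, inner_add_right, inner_add_right, hdV _ hVw, hdr0, real_inner_self_eq_norm_sq]
        ring
      rw [inner_sub_left, real_inner_smul_left, real_inner_smul_left, inner_add_right,
        inner_add_right, real_inner_smul_right, real_inner_smul_right, hrU v (h hv), hdV v hv,
        e1, e2]
      ring) θ
  have hzn : ‖‖d‖ ^ 2 • r - ‖r‖ ^ 2 • d‖ ^ 2 = ‖d‖ ^ 2 * ‖r‖ ^ 2 * (‖r‖ ^ 2 + ‖d‖ ^ 2) := by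
    rw [norm_sub_sq_real, norm_smul, norm_smul, inner_smul_left, inner_smul_right, hrd0]
    simp
    ring
  have hzi : inner ℝ (‖d‖ ^ 2 • r - ‖r‖ ^ 2 • d) θ = ‖d‖ ^ 2 * s - ‖r‖ ^ 2 * t := by
    rw [inner_sub_left, real_inner_smul_left, real_inner_smul_left, hs, ht']
  rw [hzn, hzi] at hz
  rcases eq_or_ne r 0 with h0 | h0
  · rw [hs, h0, inner_zero_left]; linarith
  rcases eq_or_ne d 0 with h0' | h0'
  · rw [ht', h0', inner_zero_left]; linarith
  have hpos : 0 < ‖d‖ ^ 2 * ‖r‖ ^ 2 := by positivity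
  set g := ‖(U ⊔ ℝ ∙ w).starProjection θ‖ ^ 2 - ‖(V ⊔ ℝ ∙ w).starProjection θ‖ ^ 2
  have hg : 0 ≤ g := sub_nonneg.2 hmono
  refine le_of_mul_le_mul_left ?_ hpos
  have hle2 : ‖d‖ ^ 2 * ‖r‖ ^ 2 * ((‖r‖ ^ 2 + ‖d‖ ^ 2) * g) ≤ ‖d‖ ^ 2 * ‖r‖ ^ 2 * g :=
    mul_le_mul_of_nonneg_left (mul_le_of_le_one_left hg hnorm) hpos.le
  nlinarith [sq_nonneg (‖d‖ ^ 2 * s + ‖r‖ ^ 2 * t)]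

/-- The potential of a pivot vector does not increase when the subspace spanned by the other
vectors shrinks. -/
theorem exp_starProjection_mul_dampedMgf_le {U V : Submodule ℝ E} (h : V ≤ U) {w : E}
    (hw : ‖w‖ ≤ 1) (θ : E) {x : ℝ} (hx : |x| ≤ 1) :
    Real.exp (‖(V ⊔ ℝ ∙ w).starProjection θ‖ ^ 2) *
        dampedMgf x (inner ℝ (w - V.starProjection w) θ) ≤
      Real.exp (‖(U ⊔ ℝ ∙ w).starProjection θ‖ ^ 2) *
        dampedMgf x (inner ℝ (w - U.starProjection w) θ) := by
  have hmono := norm_sq_starProjection_mono (sup_le_sup_right h (ℝ ∙ w)) θ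
  obtain ⟨s, hs⟩ : ∃ s : ℝ, s = inner ℝ (w - U.starProjection w) θ := ⟨_, rfl⟩
  obtain ⟨t, ht⟩ : ∃ t : ℝ, s + t = inner ℝ (w - V.starProjection w) θ :=
    ⟨inner ℝ (w - V.starProjection w) θ - s, by ring⟩
  rw [← hs, ← ht]
  rcases le_total 0 (s * t) with hst | hst
  · exact mul_le_mul (Real.exp_le_exp.2 hmono) (dampedMgf_add_le_of_mul_nonneg hx hst)
      (dampedMgf_nonneg hx _) (Real.exp_pos _).le
  · have hgap := neg_four_mul_le_starProjection_gap h hw θ hs ht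
    calc _ ≤ Real.exp (‖(V ⊔ ℝ ∙ w).starProjection θ‖ ^ 2) *
          (dampedMgf x s * Real.exp (-(4 * (s * t)))) :=
        mul_le_mul_of_nonneg_left (dampedMgf_add_le_of_mul_nonpos hx hst) (Real.exp_pos _).le
      _ = Real.exp (‖(V ⊔ ℝ ∙ w).starProjection θ‖ ^ 2 + -(4 * (s * t))) * dampedMgf x s := by
        rw [Real.exp_add]; ring
      _ ≤ _ := mul_le_mul_of_nonneg_right (Real.exp_le_exp.2 (by linarith))
        (dampedMgf_nonneg hx _)

end Projection

/-! ### The Gram–Schmidt walk and its potential -/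

/-- A point of the cube can be moved along a direction with a coordinate of absolute value one
until it reaches the boundary of the cube. -/
theorem exists_nonneg_step_to_cube_boundary {ι : Type*} (S : Finset ι) (x u : ι → ℝ) {p : ι}
    (hp : p ∈ S) (hu : |u p| = 1) (hx : ∀ j ∈ S, |x j| ≤ 1) :
    ∃ δ : ℝ, 0 ≤ δ ∧ (∀ j ∈ S, |x j + δ * u j| ≤ 1) ∧ ∃ j ∈ S, |x j + δ * u j| = 1 := by
  have hS : S.Nonempty := ⟨p, hp⟩
  let f : ℝ → ℝ := fun δ => S.sup' hS fun j => |x j + δ * u j|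
  have hf : Continuous f := Continuous.finset_sup'_apply hS fun j _ => by fun_prop
  have h0 : f 0 ≤ 1 := Finset.sup'_le _ _ fun j hj => by simpa using hx j hj
  -- Step length 2 suffices: coordinate `p` moves by 2 from a point of `[-1, 1]`, so the
  -- intermediate value theorem applies on `[0, 2]`.
  have h2 : 1 ≤ f 2 := by
    refine le_trans ?_ (Finset.le_sup' (fun j => |x j + 2 * u j|) hp)
    have e1 := abs_sub_abs_le_abs_sub (2 * u p) (-x p)
    rw [abs_mul, hu, abs_neg, sub_neg_eq_add, add_comm (2 * u p)] at e1
    have e2 := hx p hp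
    norm_num at e1
    linarith
  obtain ⟨δ, hδ, hδ1⟩ := intermediate_value_Icc (zero_le_two (α := ℝ)) hf.continuousOn ⟨h0, h2⟩
  refine ⟨δ, hδ.1, fun j hj => ?_, ?_⟩
  · rw [← hδ1]
    exact Finset.le_sup' (fun j => |x j + δ * u j|) hj
  · obtain ⟨j, hj, hje⟩ := Finset.exists_mem_eq_sup' hS fun j => |x j + δ * u j|
    exact ⟨j, hj, hje.symm.trans hδ1⟩

/-- The span of the vectors indexed by `B`. -/
def spanOf {E ι : Type*} [NormedAddCommGroup E] [InnerProductSpace ℝ E] (w : ι → E)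
    (B : Finset ι) : Submodule ℝ E :=
  Submodule.span ℝ (w '' B)

theorem spanOf_mono {E ι : Type*} [NormedAddCommGroup E] [InnerProductSpace ℝ E]
    (w : ι → E) {B C : Finset ι} (h : B ⊆ C) : spanOf w B ≤ spanOf w C :=
  Submodule.span_mono (Set.image_mono (Finset.coe_subset.2 h))

theorem spanOf_insert {E ι : Type*} [NormedAddCommGroup E] [InnerProductSpace ℝ E]
    [DecidableEq ι] (w : ι → E) (B : Finset ι) (p : ι) :
    spanOf w (insert p B) = spanOf w B ⊔ ℝ ∙ w p := by
  rw [spanOf, Finset.coe_insert, Set.image_insert_eq, Submodule.span_insert, sup_comm, spanOf]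

section Walk

variable {E : Type*} [NormedAddCommGroup E] [InnerProductSpace ℝ E] [FiniteDimensional ℝ E]
  {ι κ : Type*} [Fintype ι] [DecidableEq ι] [Fintype κ]

/-- The potential of the Gram–Schmidt walk at `x` with pivot `p` and further free
coordinates `B`, for the test vectors `θ`. -/
noncomputable def pivotPotential (w : ι → E) (θ : κ → E) (B : Finset ι) (p : ι) (x : ι → ℝ) : ℝ :=
  ∑ i, Real.exp (inner ℝ (∑ j, x j • w j) (θ i)) *
    (Real.exp (‖(spanOf w (insert p B)).starProjection (θ i)‖ ^ 2) *
      dampedMgf (x p) (inner ℝ (w p - (spanOf w B).starProjection (w p)) (θ i)))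

/-- The potential of the Gram–Schmidt walk at `x` with free coordinates `B` and no pivot. -/
noncomputable def freePotential (w : ι → E) (θ : κ → E) (B : Finset ι) (x : ι → ℝ) : ℝ :=
  ∑ i, Real.exp (inner ℝ (∑ j, x j • w j) (θ i)) *
    Real.exp (‖(spanOf w B).starProjection (θ i)‖ ^ 2)

theorem pivotPotential_le_freePotential (w : ι → E) (θ : κ → E) (B : Finset ι) (p : ι)
    {x : ι → ℝ} (hx : |x p| ≤ 1) :
    pivotPotential w θ B p x ≤ freePotential w θ (insert p B) x :=
  Finset.sum_le_sum fun _ _ => mul_le_mul_of_nonneg_left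
    (mul_le_of_le_one_right (Real.exp_pos _).le (dampedMgf_le_one hx _)) (Real.exp_pos _).le

/-- For a frozen pivot `signMgf` is 1, leaving the factor `exp (-s ^ 2)`. Since `s` pairs `θ` with a
vector of norm at most one in the larger span, orthogonal to the smaller, `s²` is at most the drop
in squared projection length. -/
theorem freePotential_le_pivotPotential (w : ι → E) (hw : ∀ j, ‖w j‖ ≤ 1) (θ : κ → E)
    (B : Finset ι) (p : ι) {x : ι → ℝ} (hx : |x p| = 1) :
    freePotential w θ B x ≤ pivotPotential w θ B p x := by
  refine Finset.sum_le_sum fun i _ => mul_le_mul_of_nonneg_left ?_ (Real.exp_pos _).le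
  have hle := spanOf_mono w (Finset.subset_insert p B)
  have hnorm : ‖w p - (spanOf w B).starProjection (w p)‖ ≤ 1 := by
    rw [← Submodule.starProjection_orthogonal_val]
    exact ((spanOf w B)ᗮ.norm_starProjection_apply_le (w p)).trans (hw p)
  have hgap := inner_sq_le_norm_sq_mul_starProjection_gap hle
    (z := w p - (spanOf w B).starProjection (w p))
    (Submodule.sub_mem _
      (Submodule.subset_span ⟨p, Finset.mem_coe.2 (Finset.mem_insert_self p B), rfl⟩)
      (hle ((spanOf w B).starProjection_apply_mem (w p))))
    (fun y hy => (spanOf w B).starProjection_inner_eq_zero (w p) y hy) (θ i)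
  rw [dampedMgf, signMgf_of_abs_eq_one hx, one_mul, ← Real.exp_add, Real.exp_le_exp]
  have := mul_le_of_le_one_left (sub_nonneg.2 (norm_sq_starProjection_mono hle (θ i)))
    (pow_le_one₀ (norm_nonneg _) hnorm (n := 2))
  linarith

theorem pivotPotential_mono (w : ι → E) (hw : ∀ j, ‖w j‖ ≤ 1) (θ : κ → E) {B C : Finset ι}
    (h : B ⊆ C) (p : ι) {x : ι → ℝ} (hx : |x p| ≤ 1) :
    pivotPotential w θ B p x ≤ pivotPotential w θ C p x := by
  refine Finset.sum_le_sum fun i _ => mul_le_mul_of_nonneg_left ?_ (Real.exp_pos _).le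
  simp only [spanOf_insert]
  exact exp_starProjection_mul_dampedMgf_le (spanOf_mono w h) (hw p) (θ i) hx

/-- Moving `x` in the direction that changes `∑ j, x j • w j` by the component of the pivot vector
orthogonal to the free vectors changes the potential in an affine way. -/
theorem exists_affine_direction (w : ι → E) (θ : κ → E) {B : Finset ι} {p : ι} (hp : p ∉ B)
    (x : ι → ℝ) :
    ∃ (u : ι → ℝ) (b : ℝ), u p = 1 ∧ (∀ j, j ∉ insert p B → u j = 0) ∧
      ∀ δ : ℝ, pivotPotential w θ B p (fun j => x j + δ * u j) =
        pivotPotential w θ B p x + δ * b := by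
  obtain ⟨c, hc⟩ : ∃ c : ι → ℝ, ∑ j ∈ B, c j • w j = (spanOf w B).starProjection (w p) := by
    exact (Submodule.mem_span_image_finset_iff_exists_fun' ℝ).1
      ((spanOf w B).starProjection_apply_mem (w p))
  let u : ι → ℝ := fun j => if j = p then 1 else if j ∈ B then -c j else 0
  have hu : ∑ j, u j • w j = w p - (spanOf w B).starProjection (w p) := by
    have e : ∀ j, u j • w j = (if j = p then w j else 0) - (if j ∈ B then c j • w j else 0) := by
      intro j
      by_cases h1 : j = p
      · subst h1; simp [u, hp]
      · by_cases h2 : j ∈ B <;> simp [u, h1, h2]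
    simp only [e, Finset.sum_sub_distrib]
    simp [← hc]
  refine ⟨u, ∑ i, Real.exp (inner ℝ (∑ j, x j • w j) (θ i)) *
    (Real.exp (‖(spanOf w (insert p B)).starProjection (θ i)‖ ^ 2) *
      (Real.exp (-(x p * inner ℝ (w p - (spanOf w B).starProjection (w p)) (θ i))) *
        Real.sinh (inner ℝ (w p - (spanOf w B).starProjection (w p)) (θ i)) *
        Real.exp (-(inner ℝ (w p - (spanOf w B).starProjection (w p)) (θ i)) ^ 2))),
    by simp [u], fun j hj => ?_, fun δ => ?_⟩
  · rw [Finset.mem_insert, not_or] at hj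
    simp [u, hj.1, hj.2]
  · rw [pivotPotential, pivotPotential, Finset.mul_sum, ← Finset.sum_add_distrib]
    refine Finset.sum_congr rfl fun i _ => ?_
    have e : ∑ j, (x j + δ * u j) • w j =
        ∑ j, x j • w j + δ • (w p - (spanOf w B).starProjection (w p)) := by
      rw [← hu, Finset.smul_sum, ← Finset.sum_add_distrib]
      exact Finset.sum_congr rfl fun j _ => by rw [add_smul, mul_smul]
    have hup : u p = 1 := by simp [u]
    rw [e, inner_add_left, real_inner_smul_left, hup, mul_one]
    generalize inner ℝ (w p - (spanOf w B).starProjection (w p)) (θ i) = s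
    -- The factor `exp (δ * s)` gained by the signed sum cancels against the centring of `signMgf`,
    -- leaving `cosh s + (x p + δ) * sinh s`, which is affine in `δ`.
    have e2 : Real.exp (-((x p + δ) * s)) = Real.exp (-(x p * s)) * Real.exp (-(δ * s)) := by
      rw [← Real.exp_add]; ring_nf
    have e3 : Real.exp (δ * s) * Real.exp (-(δ * s)) = 1 := by rw [← Real.exp_add]; simp
    rw [dampedMgf, dampedMgf, signMgf, signMgf, Real.exp_add, e2]
    linear_combination (Real.exp (inner ℝ (∑ j, x j • w j) (θ i)) *
      (Real.exp (‖(spanOf w (insert p B)).starProjection (θ i)‖ ^ 2) *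
      (Real.exp (-(x p * s)) * (Real.cosh s + (x p + δ) * Real.sinh s) *
        Real.exp (-s ^ 2)))) * e3

/-- One step of the Gram–Schmidt walk. -/
theorem exists_pivot_step (w : ι → E) (θ : κ → E) {B : Finset ι} {p : ι} (hp : p ∉ B)
    (x : ι → ℝ) (hx : ∀ j, |x j| ≤ 1) (hfix : ∀ j, j ∉ insert p B → |x j| = 1) :
    ∃ y : ι → ℝ, (∀ j, |y j| ≤ 1) ∧ (∀ j, j ∉ insert p B → |y j| = 1) ∧
      (∃ j ∈ insert p B, |y j| = 1) ∧ pivotPotential w θ B p y ≤ pivotPotential w θ B p x := by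
  obtain ⟨u, b, hup, hu0, hpot⟩ := exists_affine_direction w θ hp x
  obtain ⟨σ, hσ, hσb⟩ : ∃ σ : ℝ, |σ| = 1 ∧ σ * b ≤ 0 := by
    rcases le_total 0 b with hb | hb
    · exact ⟨-1, by simp, by linarith⟩
    · exact ⟨1, by simp, by linarith⟩
  obtain ⟨δ, hδ, hcube, htight⟩ := exists_nonneg_step_to_cube_boundary (insert p B) x
    (fun j => σ * u j) (Finset.mem_insert_self p B) (by simp [hup, hσ]) fun j _ => hx j
  simp only [← mul_assoc] at hcube htight
  have hout : ∀ j, j ∉ insert p B → |x j + δ * σ * u j| = 1 := fun j hj => by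
    rw [hu0 j hj, mul_zero, add_zero, hfix j hj]
  refine ⟨fun j => x j + δ * σ * u j, fun j => ?_, hout, htight, ?_⟩
  · by_cases hj : j ∈ insert p B
    · exact hcube j hj
    · exact (hout j hj).le
  · rw [hpot, mul_assoc]
    nlinarith [mul_nonpos_of_nonneg_of_nonpos hδ hσb]

/-- The inductive step without a pivot: any free coordinate may become the pivot, which leaves fewer
than `N` others. With none left, `x` is already a sign vector. -/
theorem exists_sign_of_free {w : ι → E} {θ : κ → E} {N : ℕ}
    (ih : ∀ (B : Finset ι) (p : ι), B.card < N → p ∉ B → ∀ x : ι → ℝ, (∀ j, |x j| ≤ 1) →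
      (∀ j, j ∉ insert p B → |x j| = 1) → ∃ y : ι → ℝ, (∀ j, |y j| = 1) ∧
        ∑ i, Real.exp (inner ℝ (∑ j, y j • w j) (θ i)) ≤ pivotPotential w θ B p x)
    {B : Finset ι} (hB : B.card ≤ N) (x : ι → ℝ) (hx : ∀ j, |x j| ≤ 1)
    (hfix : ∀ j, j ∉ B → |x j| = 1) :
    ∃ y : ι → ℝ, (∀ j, |y j| = 1) ∧
      ∑ i, Real.exp (inner ℝ (∑ j, y j • w j) (θ i)) ≤ freePotential w θ B x := by
  rcases B.eq_empty_or_nonempty with rfl | ⟨p, hp⟩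
  · exact ⟨x, fun j => hfix j (Finset.notMem_empty j), Finset.sum_le_sum fun i _ =>
      le_mul_of_one_le_right (Real.exp_pos _).le (Real.one_le_exp (sq_nonneg _))⟩
  · have hins := Finset.insert_erase hp
    obtain ⟨y, hy, hle⟩ := ih (B.erase p) p
      ((Finset.card_erase_lt_of_mem hp).trans_le hB) (Finset.notMem_erase p B) x hx
      (by rwa [hins])
    refine ⟨y, hy, hle.trans ?_⟩
    simpa only [hins] using pivotPotential_le_freePotential w θ (B.erase p) p (hx p)

/-- Each walk step freezes either the pivot, which is then replaced, or a member of `B`, with the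
same pivot kept; both decrease the number of non-pivot free coordinates or finish. -/
theorem exists_sign_of_pivot (w : ι → E) (hw : ∀ j, ‖w j‖ ≤ 1) (θ : κ → E) (N : ℕ) :
    ∀ (B : Finset ι) (p : ι), B.card < N → p ∉ B → ∀ x : ι → ℝ, (∀ j, |x j| ≤ 1) →
      (∀ j, j ∉ insert p B → |x j| = 1) → ∃ y : ι → ℝ, (∀ j, |y j| = 1) ∧
        ∑ i, Real.exp (inner ℝ (∑ j, y j • w j) (θ i)) ≤ pivotPotential w θ B p x := by
  induction N with
  | zero => exact fun B p hB => absurd hB (Nat.not_lt_zero _)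
  | succ N ih =>
    intro B p hB hp x hx hfix
    obtain ⟨z, hz, hzfix, ⟨j, hj, hjz⟩, hle⟩ := exists_pivot_step w θ hp x hx hfix
    by_cases hjp : j = p
    · subst hjp
      obtain ⟨y, hy, hyle⟩ := exists_sign_of_free ih (Nat.lt_succ_iff.1 hB)
        z hz (fun i hi => by
          by_cases hij : i = j
          · rw [hij, hjz]
          · exact hzfix i (by simp [hij, hi]))
      exact ⟨y, hy, hyle.trans ((freePotential_le_pivotPotential w hw θ B j hjz).trans hle)⟩
    · have hjB : j ∈ B := (Finset.mem_insert.1 hj).resolve_left hjp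
      have hcard := Finset.card_erase_lt_of_mem hjB
      obtain ⟨y, hy, hyle⟩ := ih (B.erase j) p (by omega)
        (fun h => hp (Finset.mem_of_mem_erase h)) z hz (fun i hi => by
          by_cases hij : i = j
          · rw [hij, hjz]
          · exact hzfix i (by simpa [hij] using hi))
      exact ⟨y, hy, hyle.trans ((pivotPotential_mono w hw θ (Finset.erase_subset j B) p
        (hz p)).trans hle)⟩

/-- Vectors of norm at most one have a signed sum that is subgaussian with respect to any finite
family of test vectors. -/
theorem exists_sign_sum_exp_inner_le (w : ι → E) (hw : ∀ j, ‖w j‖ ≤ 1) (θ : κ → E) :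
    ∃ y : ι → ℝ, (∀ j, |y j| = 1) ∧
      ∑ i, Real.exp (inner ℝ (∑ j, y j • w j) (θ i)) ≤ ∑ i, Real.exp (‖θ i‖ ^ 2) := by
  obtain ⟨y, hy, hle⟩ := exists_sign_of_free (exists_sign_of_pivot w hw θ (Fintype.card ι))
    (Finset.card_le_univ Finset.univ) (fun _ => 0) (by simp) (by simp)
  refine ⟨y, hy, hle.trans (Finset.sum_le_sum fun i _ => ?_)⟩
  simp only [zero_smul, Finset.sum_const_zero, inner_zero_left, Real.exp_zero, one_mul]
  exact Real.exp_le_exp.2 (pow_le_pow_left₀ (norm_nonneg _)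
    ((spanOf w Finset.univ).norm_starProjection_apply_le (θ i)) 2)

end Walk

/-! ### From exponential sums to the discrepancy bound -/

/-- Finitely many test vectors can be balanced simultaneously by one signed sum. -/
theorem exists_sign_abs_inner_le {E ι : Type*} [NormedAddCommGroup E] [InnerProductSpace ℝ E]
    [FiniteDimensional ℝ E] [Fintype ι] (w : ι → E) (hw : ∀ j, ‖w j‖ ≤ 1)
    {k : ℕ} (hk : 2 ≤ k) (u : Fin k → E) :
    ∃ y : ι → ℝ, (∀ j, |y j| = 1) ∧
      ∀ i, |inner ℝ (∑ j, y j • w j) (u i)| ≤ 3 * (‖u i‖ * √(Real.log k)) := by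
  classical
  have hk' : (2 : ℝ) ≤ k := by exact_mod_cast hk
  have hlog : 0 < Real.log k := Real.log_pos (by linarith)
  obtain ⟨L, hL⟩ : ∃ L, L = √(Real.log k) := ⟨_, rfl⟩
  have hLpos : 0 < L := hL ▸ Real.sqrt_pos.2 hlog
  have hL2 : L ^ 2 = Real.log k := hL ▸ Real.sq_sqrt hlog.le
  -- Length `L = √(log k)` makes each `exp ‖φ i‖²` at most `k`. The `2k` vectors `±φ i` then give a
  -- total of at most `2k² ≤ k³`, whence the constant 3. If `u i = 0`, then `φ i = 0`.
  let φ : Fin k → E := fun i => (L * ‖u i‖⁻¹) • u i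
  have hφ : ∀ i, ‖φ i‖ ≤ L := fun i => by
    rw [norm_smul, norm_mul, norm_inv, norm_norm, Real.norm_of_nonneg hLpos.le, mul_assoc]
    exact mul_le_of_le_one_right hLpos.le (inv_mul_le_one_of_le₀ le_rfl (norm_nonneg _))
  obtain ⟨y, hy, hle⟩ := exists_sign_sum_exp_inner_le w hw
    (Sum.elim φ fun i => -φ i : Fin k ⊕ Fin k → E)
  refine ⟨y, hy, fun i => ?_⟩
  have hbound : ∑ a, Real.exp (‖(Sum.elim φ fun i => -φ i : Fin k ⊕ Fin k → E) a‖ ^ 2) ≤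
      Real.exp (3 * Real.log k) := by
    have h1 : ∀ a, Real.exp (‖(Sum.elim φ fun i => -φ i : Fin k ⊕ Fin k → E) a‖ ^ 2) ≤ k := by
      intro a
      rw [← Real.le_log_iff_exp_le (by linarith), ← hL2]
      refine pow_le_pow_left₀ (norm_nonneg _) ?_ 2
      rcases a with a | a
      · exact hφ a
      · simpa using hφ a
    have h2 : Real.exp (3 * Real.log k) = (k : ℝ) ^ 3 := by
      rw [← Real.log_rpow (by linarith), Real.exp_log (by positivity)]
      norm_cast
    refine (Finset.sum_le_sum fun a _ => h1 a).trans ?_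
    rw [h2]
    simp
    nlinarith [mul_self_nonneg (k : ℝ)]
  have hterm : ∀ a, inner ℝ (∑ j, y j • w j)
      ((Sum.elim φ fun i => -φ i : Fin k ⊕ Fin k → E) a) ≤ 3 * L ^ 2 := fun a => by
    rw [hL2, ← Real.exp_le_exp]
    exact ((Finset.single_le_sum (fun a _ => (Real.exp_pos _).le) (Finset.mem_univ a)).trans
      hle).trans hbound
  have habs : |inner ℝ (∑ j, y j • w j) (φ i)| ≤ 3 * L ^ 2 := by
    refine abs_le'.2 ⟨hterm (Sum.inl i), ?_⟩
    have := hterm (Sum.inr i)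
    rwa [Sum.elim_inr, inner_neg_right] at this
  rcases eq_or_ne (u i) 0 with h0 | h0
  · simp [h0]
  have hu : 0 < ‖u i‖ := norm_pos_iff.2 h0
  rw [real_inner_smul_right, abs_mul, abs_of_pos (by positivity)] at habs
  rw [← hL]
  refine le_of_mul_le_mul_left (habs.trans_eq ?_) (by positivity : 0 < L * ‖u i‖⁻¹)
  field_simp

theorem lemma3p2 :
    ∃ C : ℝ, 0 < C ∧
      ∀ (m n k : ℕ), 2 ≤ k →
      ∀ (A : Matrix (Fin m) (Fin n) ℝ) (F : Matrix (Fin m) (Fin m) ℝ),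
        F.rank = m →
        (∀ j : Fin n, A.col j ∈ ellipsoidOf F) →
        ∀ v : Fin k → Fin m → ℝ,
          ∃ x : Fin n → ℝ, (∀ j, x j = 1 ∨ x j = -1) ∧
            ∀ i : Fin k,
              |(A *ᵥ x) ⬝ᵥ v i| ≤
                C * Real.sqrt ((v i ⬝ᵥ ((F * Fᵀ) *ᵥ v i)) * Real.log (k : ℝ)) := by
  refine ⟨3, by norm_num, fun m n k hk A F _ hA v => ?_⟩
  choose w hw hwA using hA
  obtain ⟨x, hx, hxv⟩ := exists_sign_abs_inner_le
    (fun j => (WithLp.toLp 2 (w j) : EuclideanSpace ℝ (Fin m))) hw hk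
    (fun i => (WithLp.toLp 2 (Fᵀ *ᵥ v i) : EuclideanSpace ℝ (Fin m)))
  refine ⟨x, fun j => (abs_eq zero_le_one).1 (hx j), fun i => ?_⟩
  have hinner : inner ℝ (∑ j, x j • (WithLp.toLp 2 (w j) : EuclideanSpace ℝ (Fin m)))
      (WithLp.toLp 2 (Fᵀ *ᵥ v i)) = (A *ᵥ x) ⬝ᵥ v i := by
    have hAx : A *ᵥ x = ∑ j, x j • A.col j := by
      rw [Matrix.mulVec_eq_sum]
      simp only [op_smul_eq_smul]
      rfl
    rw [sum_inner, hAx, sum_dotProduct]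
    refine Finset.sum_congr rfl fun j _ => ?_
    rw [real_inner_smul_left, smul_dotProduct, ← hwA j, EuclideanSpace.inner_toLp_toLp,
      star_trivial, dotProduct_comm, Matrix.dotProduct_mulVec, Matrix.vecMul_transpose,
      smul_eq_mul]
  have hnorm : ‖(WithLp.toLp 2 (Fᵀ *ᵥ v i) : EuclideanSpace ℝ (Fin m))‖ =
      √(v i ⬝ᵥ ((F * Fᵀ) *ᵥ v i)) := by
    rw [← Matrix.mulVec_mulVec, Matrix.dotProduct_mulVec, ← Matrix.mulVec_transpose,
      ← Real.sqrt_sq (norm_nonneg _), ← real_inner_self_eq_norm_sq,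
      EuclideanSpace.inner_toLp_toLp, star_trivial]
  have hnn : 0 ≤ v i ⬝ᵥ ((F * Fᵀ) *ᵥ v i) := by
    rw [← Matrix.mulVec_mulVec, Matrix.dotProduct_mulVec, ← Matrix.mulVec_transpose]
    exact Finset.sum_nonneg fun _ _ => mul_self_nonneg _
  rw [← hinner, Real.sqrt_mul hnn, ← hnorm]
  exact hxv i
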